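/- Let $X_1,X_2,\dots$ be i.i.d. random variables with values in a measurable space $\mathcal X$, let $\Theta$ be a measurable space, let $f:\Theta\times\mathcal X\to[0,1]$ be measurable, and put $\mu_\theta=\mathbb E[f(\theta,X_1)]$. Let $P_0$ be a probability measure on $\Theta$ that does not depend on the data, and let $\delta\in(0,1]$. For $n\in\mathbb N$, $\theta\in\Theta$ and $m\in[0,1]$ let $$\psi_n^{\star}(\theta,m)=\max_{\lambda\in[-\frac1{1-m},\frac1m]}\ \sum_{i=1}^n\ln\bigl(1+\lambda\,(f(\theta,X_i)-m)\bigr)\in[0,\infty],$$ where $\ln 0=-\infty$, $1/0=\infty$, and for $m\in\{0,1\}$ the maximum is the supremum over the real numbers $\lambda$ in the range. For a data-dependent probability measure $P_n$ on $\Theta$ (a probability kernel from $\mathcal X^n$ to $\Theta$, evaluated at $(X_1,\dots,X_n)$) let $$\mathcal C_n=\mathrm{KL}(P_n\,\|\,P_0)+\ln\frac{\sqrt\pi\,\Gamma(n+1)}{\Gamma(n+\frac12)},$$ with $\mathrm{KL}(P_n\,\|\,P_0)=\infty$ if $P_n\not\ll P_0$, and let $M_U$ and $M_L$ be the maximum and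 the minimum of $$\int\nu_\theta\,dP_n(\theta)\quad\text{over measurable }\nu:\Theta\to[0,1]\ \text{ subject to }\ \int\psi_n^{\star}(\theta,\nu_\theta)\,dP_n(\theta)\le\mathcal C_n+\ln\frac1\delta .$$ The maximum and the minimum exist for every $n$, every sample and every $P_n$, and with probability at least $1-\delta$, simultaneously for all $n\in\mathbb N$ and all data-dependent $P_n$, $$M_L\le\int\mu_\theta\,dP_n(\theta)\le M_U .$$ -/

import Mathlib

open MeasureTheory ProbabilityTheory

noncomputable section

/-- The betting range `[-1/(1-m), 1/m]` for `m ∈ [0,1]`, with `1/0 = ∞`; clearing the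
denominators makes the end points right also for `m = 0` and `m = 1`. -/
def betRange (m : ℝ) : Set ℝ :=
  {l | -1 ≤ l * (1 - m) ∧ l * m ≤ 1}

/-- The optimal log-wealth
`ψ⋆(m) = sup_{l ∈ [-1/(1-m), 1/m]} ∑ i, ln (1 + l (c i - m))` of the outcomes
`c 0, …, c (n-1) ∈ [0,1]`, with values in the extended reals: `ENNReal.log 0 = -∞`, and the
supremum may be `+∞` when `m ∈ {0, 1}`. -/
def optLogWealth {n : ℕ} (c : Fin n → ℝ) (m : ℝ) : EReal :=
  ⨆ l ∈ betRange m, ∑ i, ENNReal.log (ENNReal.ofReal (1 + l * (c i - m)))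

/-- The optimal log-wealth is nonnegative, so `EReal.toENNReal` loses nothing on it. -/
theorem optLogWealth_nonneg {n : ℕ} (c : Fin n → ℝ) (m : ℝ) : 0 ≤ optLogWealth c m := by
  have h : (0 : ℝ) ∈ betRange m := by simp [betRange]
  refine le_trans ?_ (le_iSup₂ (f := fun (l : ℝ) (_ : l ∈ betRange m) =>
    ∑ i, ENNReal.log (ENNReal.ofReal (1 + l * (c i - m)))) 0 h)
  simp

/-- `C_n = KL(Q ‖ P₀) + ln (√π Γ(n+1) / Γ(n+1/2))`. -/
def complexity {Θ : Type*} [MeasurableSpace Θ] (P₀ Q : Measure Θ) (n : ℕ) : EReal :=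
  (InformationTheory.klDiv Q P₀ : EReal) +
    (Real.log (√Real.pi * Real.Gamma (n + 1) / Real.Gamma (n + 1 / 2)) : EReal)

/-- The candidate mean functions: measurable `ν : Θ → [0,1]` with
`∫ ψ⋆_n(θ, ν θ) dQ(θ) ≤ C_n + ln (1/δ)`, for the sample `x` of size `n`. -/
def feasibleMeans {Θ 𝒳 : Type*} [MeasurableSpace Θ] (f : Θ × 𝒳 → ℝ) (P₀ Q : Measure Θ)
    (δ : ℝ) {n : ℕ} (x : Fin n → 𝒳) : Set (Θ → ℝ) :=
  {ν | Measurable ν ∧ (∀ θ, ν θ ∈ Set.Icc (0 : ℝ) 1) ∧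
    ((∫⁻ θ, (optLogWealth (fun i => f (θ, x i)) (ν θ)).toENNReal ∂Q : ENNReal) : EReal)
      ≤ complexity P₀ Q n + (Real.log (1 / δ) : EReal)}

/-- The objective values `∫ ν dQ` of the feasible mean functions `ν`. -/
def objectiveValues {Θ 𝒳 : Type*} [MeasurableSpace Θ] (f : Θ × 𝒳 → ℝ) (P₀ Q : Measure Θ)
    (δ : ℝ) {n : ℕ} (x : Fin n → 𝒳) : Set ℝ :=
  (fun ν : Θ → ℝ => ∫ θ, ν θ ∂Q) '' feasibleMeans f P₀ Q δ x

/-- `M_U`, the optimal value of the maximization problem. -/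
def maxMean {Θ 𝒳 : Type*} [MeasurableSpace Θ] (f : Θ × 𝒳 → ℝ) (P₀ Q : Measure Θ)
    (δ : ℝ) {n : ℕ} (x : Fin n → 𝒳) : ℝ :=
  sSup (objectiveValues f P₀ Q δ x)

/-- `M_L`, the optimal value of the minimization problem. -/
def minMean {Θ 𝒳 : Type*} [MeasurableSpace Θ] (f : Θ × 𝒳 → ℝ) (P₀ Q : Measure Θ)
    (δ : ℝ) {n : ℕ} (x : Fin n → 𝒳) : ℝ :=
  sInf (objectiveValues f P₀ Q δ x)

end

open Filter Topology
open scoped ENNReal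

/-! A bet that is fair under mean `m` is a ratio of payoffs: `1 + l (c - m) = payoff w c / payoff w
m`, with a weight `w ∈ [0,1]` in place of the stake `l`. Rational weights in `(0,1)` suffice
(`toENNReal_optLogWealth`), so the optimal log-wealth is measurable in `θ`, and convex and lower
semicontinuous in `m`.

Coverage: mixing the bets with the Beta(1/2, 1/2) law, as Krichevsky and Trofimov do, loses at most
the factor `n! / halfRising n = √π Γ(n+1) / Γ(n+1/2)` against any single bet
(`ofReal_prod_payoff_div_le_mixtureWealth`). At the true means the mixture wealth is a
supermartingale, and so is its `P₀`-average, because `P₀` is fixed in advance. Ville's inequality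
(`mul_measure_exists_le_le_one`) keeps this average below `1/δ` for all `n` at once, outside an
event of probability at most `δ` that involves no posterior. Off that event the change of measure
`lintegral_le_klDiv_add_log` shows, for every posterior, that the true mean function is feasible;
its integral therefore lies between the two optimal values.

Attainment: the feasible functions form a nonempty bounded convex set in `L²` of the posterior,
closed by Fatou's lemma, and a continuous linear functional attains its extremes there
(`exists_forall_mul_integral_le`). Nonemptiness comes from the empirical mean, at which no bet
gains. -/

/-! ### Bets as weights on two outcomes -/

/-- The payoff at outcome `c` of the bet that puts weight `w` on `1` and `1 - w` on `0`. -/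
def payoff (w c : ℝ) : ℝ := (1 - w) * (1 - c) + w * c

theorem payoff_pos {w c : ℝ} (hw : w ∈ Set.Ioo (0 : ℝ) 1) (hc : c ∈ Set.Icc (0 : ℝ) 1) :
    0 < payoff w c := by
  obtain ⟨h0, h1⟩ := hw
  obtain ⟨c0, c1⟩ := hc
  unfold payoff
  rcases eq_or_lt_of_le c0 with rfl | hc
  · linarith
  · nlinarith [mul_pos h0 hc, mul_nonneg (sub_nonneg.2 h1.le) (sub_nonneg.2 c1)]

theorem continuous_payoff_left (c : ℝ) : Continuous fun w => payoff w c := by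
  unfold payoff; fun_prop

theorem continuous_payoff_right (w : ℝ) : Continuous fun c => payoff w c := by
  unfold payoff; fun_prop

theorem payoff_convexCombination {a b : ℝ} (hab : a + b = 1) (w u v : ℝ) :
    payoff w (a * u + b * v) = a * payoff w u + b * payoff w v := by
  obtain rfl : a = 1 - b := by linarith
  unfold payoff; ring

theorem payoff_sum (w : ℝ) {n : ℕ} (c : Fin n → ℝ) :
    ∑ i, payoff w (c i) = (1 - w) * (n - ∑ i, c i) + w * ∑ i, c i := by
  simp [payoff, Finset.sum_add_distrib, ← Finset.mul_sum]

/-- The logarithmic growth of the bet with weight `w`, normalized to be fair under mean `m`. -/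
noncomputable def logGain {n : ℕ} (c : Fin n → ℝ) (w m : ℝ) : ℝ :=
  ∑ i, Real.log (payoff w (c i)) - n * Real.log (payoff w m)

theorem logGain_one_half {n : ℕ} (c : Fin n → ℝ) (m : ℝ) : logGain c (1 / 2) m = 0 := by
  have h : ∀ x, payoff (1 / 2) x = 1 / 2 := fun x => by unfold payoff; ring
  simp only [logGain, h]
  simp

/-- A countable set of weights that suffices for the optimal log-wealth. -/
def rationalWeights : Set ℝ := Set.Ioo 0 1 ∩ Set.range ((↑) : ℚ → ℝ)

theorem rationalWeights_countable : rationalWeights.Countable :=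
  (Set.countable_range _).mono Set.inter_subset_right

theorem one_half_mem_rationalWeights : (1 / 2 : ℝ) ∈ rationalWeights :=
  ⟨by norm_num, 1 / 2, by norm_num⟩

theorem Icc_subset_closure_rationalWeights : Set.Icc (0 : ℝ) 1 ⊆ closure rationalWeights := by
  rw [← closure_Ioo zero_ne_one]
  exact closure_minimal
    ((Rat.denseRange_cast (𝕜 := ℝ)).open_subset_closure_inter isOpen_Ioo) isClosed_closure

/-! ### The optimal log-wealth as a countable supremum -/

theorem ereal_sum_log_ofReal {n : ℕ} {y : Fin n → ℝ} (hy : ∀ i, 0 < y i) :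
    ∑ i, ENNReal.log (ENNReal.ofReal (y i)) = ((∑ i, Real.log (y i) : ℝ) : EReal) := by
  rw [Finset.sum_congr rfl fun i _ => ENNReal.log_ofReal_of_pos (hy i)]
  exact (map_sum (⟨⟨Real.toEReal, rfl⟩, EReal.coe_add⟩ : ℝ →+ EReal) _ _).symm

theorem sum_log_div_payoff {n : ℕ} {y : Fin n → ℝ} {d : ℝ} (hy : ∀ i, 0 < y i) (hd : 0 < d) :
    ∑ i, Real.log (y i / d) = ∑ i, Real.log (y i) - n * Real.log d := by
  simp [Real.log_div (hy _).ne' hd.ne', Finset.sum_sub_distrib]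

/-- The weight `w` is the stake `(2w - 1) / payoff w m`. It lies in the betting range because its
payoffs at the outcomes 0 and 1 are nonnegative. -/
theorem logGain_le_optLogWealth {n : ℕ} {c : Fin n → ℝ} (hc : ∀ i, c i ∈ Set.Icc (0 : ℝ) 1)
    {m : ℝ} (hm : m ∈ Set.Icc (0 : ℝ) 1) {w : ℝ} (hw : w ∈ Set.Ioo (0 : ℝ) 1) :
    (logGain c w m : EReal) ≤ optLogWealth c m := by
  have hd := payoff_pos hw hm
  have key : ∀ x, 1 + (2 * w - 1) / payoff w m * (x - m) = payoff w x / payoff w m := by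
    intro x
    field_simp
    unfold payoff; ring
  have hmem : (2 * w - 1) / payoff w m ∈ betRange m := by
    have h1 : payoff w 1 / payoff w m = w / payoff w m := by simp [payoff]
    have h0 : payoff w 0 / payoff w m = (1 - w) / payoff w m := by simp [payoff]
    have k1 := key 1
    have k0 := key 0
    have p1 := div_pos hw.1 hd
    have p0 := div_pos (sub_pos.2 hw.2) hd
    constructor <;> linarith
  refine le_trans (le_of_eq ?_) (le_iSup₂ (f := fun (l : ℝ) (_ : l ∈ betRange m) =>
    ∑ i, ENNReal.log (ENNReal.ofReal (1 + l * (c i - m)))) _ hmem)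
  simp only [key]
  rw [ereal_sum_log_ofReal fun i => div_pos (payoff_pos hw (hc i)) hd,
    sum_log_div_payoff (fun i => payoff_pos hw (hc i)) hd]
  rfl

/-- Every stake with finite log-wealth is a weight in `[0,1]`, and continuity in the weight allows
passing to interior rational ones. The truncation at 0 is harmless since weight `1/2` gains nothing.
-/
theorem toENNReal_optLogWealth {n : ℕ} {c : Fin n → ℝ} (hc : ∀ i, c i ∈ Set.Icc (0 : ℝ) 1)
    {m : ℝ} (hm : m ∈ Set.Icc (0 : ℝ) 1) :
    (optLogWealth c m).toENNReal = ⨆ w ∈ rationalWeights, ENNReal.ofReal (logGain c w m) := by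
  apply le_antisymm
  · suffices h : optLogWealth c m ≤
        ((⨆ w ∈ rationalWeights, ENNReal.ofReal (logGain c w m) : ℝ≥0∞) : EReal) by
      simpa using EReal.toENNReal_le_toENNReal h
    refine iSup₂_le fun l hl => ?_
    obtain ⟨hl1, hl0⟩ := hl
    have hnn : ∀ x ∈ Set.Icc (0 : ℝ) 1, 0 ≤ 1 + l * (x - m) := by
      rintro x ⟨x0, x1⟩
      nlinarith
    by_cases hpos : ∀ i, 0 < 1 + l * (c i - m)
    · rw [ereal_sum_log_ofReal hpos]
      -- The sum of the payoffs of stake `l` at the outcomes 0 and 1; dividing by it turns these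
      -- payoffs into the weights `1 - v` and `v`.
      set s := 2 + l * (1 - 2 * m) with hs
      have hs0 : 0 < s := by
        obtain ⟨m0, m1⟩ := hm
        rcases le_total l 0 with h | h <;> nlinarith
      set v := (1 + l * (1 - m)) / s with hv
      have key : ∀ x, payoff v x = (1 + l * (x - m)) / s := by
        intro x
        have hvs : v * s = 1 + l * (1 - m) := div_mul_cancel₀ _ hs0.ne'
        rw [eq_div_iff hs0.ne']
        unfold payoff
        linear_combination (2 * x - 1) * hvs + (1 - x) * hs
      have hvm : payoff v m = 1 / s := by rw [key]; simp
      have hv01 : v ∈ Set.Icc (0 : ℝ) 1 := by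
        constructor
        · exact div_nonneg (by linarith) hs0.le
        · rw [hv, div_le_one hs0]; linarith
      have hval : logGain c v m = ∑ i, Real.log (1 + l * (c i - m)) := by
        unfold logGain
        simp only [key]
        rw [sum_log_div_payoff hpos hs0]
        simp
      -- Here `v` may be 0 or 1; continuity holds because all the payoffs that occur are positive at
      -- `v`.
      have hcont : ContinuousAt (fun w => logGain c w m) v := by
        unfold logGain
        refine ContinuousAt.sub (tendsto_finsetSum _ fun i _ => ?_) (ContinuousAt.mul
          continuousAt_const ?_)
        · refine ContinuousAt.log (continuous_payoff_left _).continuousAt ?_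
          rw [key]; exact (div_pos (hpos i) hs0).ne'
        · refine ContinuousAt.log (continuous_payoff_left _).continuousAt ?_
          rw [hvm]; positivity
      rw [← hval]
      refine le_of_forall_lt fun r hr => ?_
      have hcont' : Tendsto (fun w => (logGain c w m : EReal)) (𝓝 v) (𝓝 (logGain c v m : EReal)) :=
        (continuous_coe_real_ereal.tendsto _).comp hcont
      obtain ⟨w, hw, hwT⟩ := mem_closure_iff_nhds.1 (Icc_subset_closure_rationalWeights hv01) _
        (hcont'.eventually (lt_mem_nhds hr))
      refine lt_of_lt_of_le hw ?_
      have h2 : ENNReal.ofReal (logGain c w m) ≤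
          ⨆ w ∈ rationalWeights, ENNReal.ofReal (logGain c w m) :=
        le_iSup₂ (f := fun w (_ : w ∈ rationalWeights) => ENNReal.ofReal (logGain c w m)) w hwT
      refine le_trans ?_ (EReal.coe_ennreal_le_coe_ennreal_iff.2 h2)
      rw [EReal.coe_ennreal_ofReal]
      exact EReal.coe_le_coe_iff.2 (le_max_left _ _)
    · push Not at hpos
      obtain ⟨i, hi⟩ := hpos
      have : ∑ i, ENNReal.log (ENNReal.ofReal (1 + l * (c i - m))) = ⊥ := by
        rw [← Finset.add_sum_erase _ _ (Finset.mem_univ i), ENNReal.ofReal_of_nonpos hi]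
        simp
      rw [this]
      exact bot_le
  · refine iSup₂_le fun w hw => ?_
    have := EReal.toENNReal_le_toENNReal (logGain_le_optLogWealth hc hm hw.1)
    rwa [EReal.real_coe_toENNReal] at this

/-! ### Convexity, semicontinuity, zeros and measurability of the optimal log-wealth -/

theorem convexOn_logGain {n : ℕ} (c : Fin n → ℝ) {w : ℝ} (hw : w ∈ Set.Ioo (0 : ℝ) 1) :
    ConvexOn ℝ (Set.Icc 0 1) (logGain c w) := by
  refine ⟨convex_Icc 0 1, fun u hu v hv a b ha hb hab => ?_⟩
  have h := strictConcaveOn_log_Ioi.concaveOn.2 (payoff_pos hw hu) (payoff_pos hw hv) ha hb hab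
  simp only [smul_eq_mul, ← payoff_convexCombination hab] at h ⊢
  obtain rfl : a = 1 - b := by linarith
  unfold logGain
  nlinarith [mul_le_mul_of_nonneg_left h (Nat.cast_nonneg (α := ℝ) n)]

theorem toENNReal_optLogWealth_convexCombination {n : ℕ} {c : Fin n → ℝ}
    (hc : ∀ i, c i ∈ Set.Icc (0 : ℝ) 1) {u v : ℝ} (hu : u ∈ Set.Icc (0 : ℝ) 1)
    (hv : v ∈ Set.Icc (0 : ℝ) 1) {a b : ℝ} (ha : 0 ≤ a) (hb : 0 ≤ b) (hab : a + b = 1) :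
    (optLogWealth c (a * u + b * v)).toENNReal ≤
      ENNReal.ofReal a * (optLogWealth c u).toENNReal +
        ENNReal.ofReal b * (optLogWealth c v).toENNReal := by
  have huv : a * u + b * v ∈ Set.Icc (0 : ℝ) 1 := (convex_Icc (0 : ℝ) 1) hu hv ha hb hab
  rw [toENNReal_optLogWealth hc hu, toENNReal_optLogWealth hc hv, toENNReal_optLogWealth hc huv]
  refine iSup₂_le fun w hw => ?_
  calc ENNReal.ofReal (logGain c w (a * u + b * v))
      ≤ ENNReal.ofReal (a * logGain c w u + b * logGain c w v) :=
        ENNReal.ofReal_le_ofReal ((convexOn_logGain c hw.1).2 hu hv ha hb hab)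
    _ ≤ ENNReal.ofReal (a * logGain c w u) + ENNReal.ofReal (b * logGain c w v) :=
        ENNReal.ofReal_add_le
    _ = ENNReal.ofReal a * ENNReal.ofReal (logGain c w u) +
          ENNReal.ofReal b * ENNReal.ofReal (logGain c w v) := by
        rw [ENNReal.ofReal_mul ha, ENNReal.ofReal_mul hb]
    _ ≤ _ := by
        gcongr
        · exact le_iSup₂ (f := fun w (_ : w ∈ rationalWeights) =>
            ENNReal.ofReal (logGain c w u)) w hw
        · exact le_iSup₂ (f := fun w (_ : w ∈ rationalWeights) =>
            ENNReal.ofReal (logGain c w v)) w hw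

/-- A supremum of functions continuous in `m` on `[0,1]` is lower semicontinuous: for interior `w`
the denominator `payoff w m` stays positive. -/
theorem toENNReal_optLogWealth_le_liminf {n : ℕ} {c : Fin n → ℝ}
    (hc : ∀ i, c i ∈ Set.Icc (0 : ℝ) 1) {u : ℕ → ℝ} (hu : ∀ k, u k ∈ Set.Icc (0 : ℝ) 1) {m : ℝ}
    (h : Tendsto u atTop (𝓝 m)) :
    (optLogWealth c m).toENNReal ≤ liminf (fun k => (optLogWealth c (u k)).toENNReal) atTop := by
  have hm : m ∈ Set.Icc (0 : ℝ) 1 := isClosed_Icc.mem_of_tendsto h (Eventually.of_forall hu)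
  rw [toENNReal_optLogWealth hc hm]
  refine iSup₂_le fun w hw => ?_
  have hlim : Tendsto (fun k => ENNReal.ofReal (logGain c w (u k))) atTop
      (𝓝 (ENNReal.ofReal (logGain c w m))) := by
    refine ENNReal.tendsto_ofReal (tendsto_const_nhds.sub (tendsto_const_nhds.mul ?_))
    exact (((continuous_payoff_right w).tendsto m).comp h).log (payoff_pos hw.1 hm).ne'
  rw [← hlim.liminf_eq]
  refine liminf_le_liminf (Eventually.of_forall fun k => ?_)
  rw [toENNReal_optLogWealth hc (hu k)]
  exact le_iSup₂ (f := fun w (_ : w ∈ rationalWeights) => ENNReal.ofReal (logGain c w (u k))) w hw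

/-- By `log y ≤ y - 1` and affinity of the payoff, no bet has positive growth when it is fair under
the empirical mean. For `n = 0` the quotient is 0, which is as good as any value. -/
theorem toENNReal_optLogWealth_mean {n : ℕ} {c : Fin n → ℝ} (hc : ∀ i, c i ∈ Set.Icc (0 : ℝ) 1) :
    (∑ i, c i) / n ∈ Set.Icc (0 : ℝ) 1 ∧ (optLogWealth c ((∑ i, c i) / n)).toENNReal = 0 := by
  have hmem : (∑ i, c i) / n ∈ Set.Icc (0 : ℝ) 1 := by
    refine ⟨div_nonneg (Finset.sum_nonneg fun i _ => (hc i).1) n.cast_nonneg,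
      div_le_one_of_le₀ ?_ n.cast_nonneg⟩
    calc ∑ i, c i ≤ ∑ _i : Fin n, (1 : ℝ) := Finset.sum_le_sum fun i _ => (hc i).2
      _ = n := by simp
  refine ⟨hmem, ?_⟩
  rw [toENNReal_optLogWealth hc hmem]
  simp only [ENNReal.iSup_eq_zero, ENNReal.ofReal_eq_zero]
  intro w hw
  set m := (∑ i, c i) / n with hmdef
  have hd := payoff_pos hw.1 hmem
  have hsum : ∑ i, c i = n * m := by
    rcases Nat.eq_zero_or_pos n with rfl | hn
    · simp
    · rw [hmdef]; field_simp
  have h1 : logGain c w m = ∑ i, Real.log (payoff w (c i) / payoff w m) :=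
    (sum_log_div_payoff (fun i => payoff_pos hw.1 (hc i)) hd).symm
  rw [h1]
  calc ∑ i, Real.log (payoff w (c i) / payoff w m)
      ≤ ∑ i, (payoff w (c i) / payoff w m - 1) := Finset.sum_le_sum fun i _ =>
        Real.log_le_sub_one_of_pos (div_pos (payoff_pos hw.1 (hc i)) hd)
    _ = (∑ i, payoff w (c i)) / payoff w m - n := by
        simp [Finset.sum_sub_distrib, Finset.sum_div]
    _ = 0 := by
        rw [payoff_sum, hsum]
        have : (1 - w) * ((n : ℝ) - n * m) + w * (n * m) = n * payoff w m := by
          unfold payoff; ring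
        rw [this]
        field_simp
        ring

theorem measurable_toENNReal_optLogWealth {α : Type*} [MeasurableSpace α] {n : ℕ}
    {c : Fin n → α → ℝ} (hc : ∀ i, Measurable (c i))
    (hc01 : ∀ i a, c i a ∈ Set.Icc (0 : ℝ) 1) {ν : α → ℝ} (hν : Measurable ν)
    (hν01 : ∀ a, ν a ∈ Set.Icc (0 : ℝ) 1) :
    Measurable fun a => (optLogWealth (fun i => c i a) (ν a)).toENNReal := by
  simp only [toENNReal_optLogWealth (fun i => hc01 i _) (hν01 _)]
  refine Measurable.biSup _ rationalWeights_countable fun w _ => ENNReal.measurable_ofReal.comp ?_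
  unfold logGain
  refine Measurable.sub (Finset.measurable_fun_sum _ fun i _ => ?_) (measurable_const.mul ?_)
  · exact Real.measurable_log.comp ((continuous_payoff_right w).measurable.comp (hc i))
  · exact Real.measurable_log.comp ((continuous_payoff_right w).measurable.comp hν)

/-! ### Krichevsky–Trofimov probabilities and their regret -/

/-- The rising factorial `(1/2) (3/2) ⋯ (k - 1/2)`, which is `Γ(k + 1/2) / √π`. -/
noncomputable def halfRising (k : ℕ) : ℝ := ∏ j ∈ Finset.range k, ((j : ℝ) + 1 / 2)

theorem halfRising_zero : halfRising 0 = 1 := by simp [halfRising]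

theorem halfRising_succ (k : ℕ) : halfRising (k + 1) = halfRising k * (k + 1 / 2) :=
  Finset.prod_range_succ _ _

theorem halfRising_pos (k : ℕ) : 0 < halfRising k := Finset.prod_pos fun _ _ => by positivity

theorem Gamma_add_half_eq_halfRising (n : ℕ) :
    Real.Gamma (n + 1 / 2) = halfRising n * √Real.pi := by
  induction n with
  | zero => simp only [Nat.cast_zero, zero_add, halfRising_zero, one_mul, Real.Gamma_one_half_eq]
  | succ n ih =>
    rw [halfRising_succ, show ((n + 1 : ℕ) : ℝ) + 1 / 2 = (n + 1 / 2 : ℝ) + 1 by push_cast; ring,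
      Real.Gamma_add_one (by positivity), ih]
    ring

theorem sqrt_pi_mul_Gamma_div_Gamma (n : ℕ) :
    √Real.pi * Real.Gamma (n + 1) / Real.Gamma (n + 1 / 2) = n.factorial / halfRising n := by
  have h := halfRising_pos n
  have hpi : 0 < √Real.pi := Real.sqrt_pos.2 Real.pi_pos
  rw [Gamma_add_half_eq_halfRising, Real.Gamma_nat_eq_factorial]
  field_simp

theorem halfRising_le_factorial (n : ℕ) : halfRising n ≤ n.factorial := by
  induction n with
  | zero => simp [halfRising_zero]
  | succ n ih =>
    rw [halfRising_succ, Nat.factorial_succ, mul_comm]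
    push_cast
    exact mul_le_mul (by linarith) ih (halfRising_pos n).le (by positivity)

theorem one_le_factorial_div_halfRising (n : ℕ) : 1 ≤ n.factorial / halfRising n :=
  (one_le_div (halfRising_pos n)).2 (halfRising_le_factorial n)

/-- The left side is the first term of the series of positive terms `log (1 + 1/x) = 2 ∑
(2x+1)^(-(2k+1)) / (2k+1)`. -/
theorem inv_add_half_le_log_sub_log {x : ℝ} (hx : 0 < x) :
    1 / (x + 1 / 2) ≤ Real.log (x + 1) - Real.log x := by
  have h := le_hasSum (Real.hasSum_log_one_add_inv hx) 0 fun k _ => by positivity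
  rw [← Real.log_div (by positivity) hx.ne', add_div, div_self hx.ne', one_div x]
  refine le_of_eq_of_le ?_ h
  simp only [Nat.cast_zero, mul_zero, zero_add, pow_one]
  field_simp

/-- At `x = k` this is the increment from `k` to `k + 1` of `log (halfRising k) - k log k`; its
monotonicity yields the subadditivity below. -/
theorem antitoneOn_log_add_half_sub :
    AntitoneOn (fun x : ℝ => Real.log (x + 1 / 2) - (x + 1) * Real.log (x + 1) + x * Real.log x)
      (Set.Ici 0) := by
  refine antitoneOn_of_hasDerivWithinAt_nonpos (convex_Ici 0)
    (f' := fun x => 1 / (x + 1 / 2) - (Real.log (x + 1) + 1) + (Real.log x + 1)) ?_ ?_ ?_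
  · refine ContinuousOn.add (ContinuousOn.sub ?_ ?_) Real.continuous_mul_log.continuousOn
    · exact ContinuousOn.log (by fun_prop) fun x (hx : 0 ≤ x) => by positivity
    · exact (Real.continuous_mul_log.comp (continuous_add_const 1)).continuousOn
  · intro x hx
    rw [interior_Ici] at hx
    have hx : 0 < x := hx
    refine HasDerivAt.hasDerivWithinAt (HasDerivAt.add (HasDerivAt.sub ?_ ?_)
      (Real.hasDerivAt_mul_log hx.ne'))
    · exact ((hasDerivAt_id x).add_const (1 / 2)).log (by simp only [id]; positivity)
    · have := (Real.hasDerivAt_mul_log (x := x + 1) (by positivity)).comp x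
        ((hasDerivAt_id x).add_const 1)
      simp only [mul_one] at this
      exact this
  · intro x hx
    rw [interior_Ici] at hx
    linarith [inv_add_half_le_log_sub_log (show 0 < x from hx)]

/-- Induction on `j`: both sides grow by increments of the same sequence, and the increments
decrease. At 0 the convention `log 0 = 0` gives the right value. -/
theorem log_halfRising_add_le (k j : ℕ) :
    Real.log (halfRising (k + j)) - (k + j) * Real.log (k + j) ≤
      (Real.log (halfRising k) - k * Real.log k) + (Real.log (halfRising j) - j * Real.log j) := by
  induction j with
  | zero => simp [halfRising_zero]
  | succ j ih =>
    have h := antitoneOn_log_add_half_sub (a := (j : ℝ)) (b := (k : ℝ) + j)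
      (by simp) (Set.mem_Ici.2 (by positivity)) (by simp)
    rw [← add_assoc, halfRising_succ, halfRising_succ,
      Real.log_mul (halfRising_pos _).ne' (by positivity),
      Real.log_mul (halfRising_pos _).ne' (by positivity)]
    push_cast
    rw [← add_assoc]
    simp only at h
    linarith

/-- This is `log z ≤ z - 1` at `z = p y / x`. It serves both to bound a likelihood by its maximum
and to prove the change of measure. -/
theorem mul_log_le_mul_log_sub {p x y : ℝ} (hp : 0 < p) (hx : 0 < x) (hy : 0 < y) :
    x * Real.log p ≤ x * Real.log x - x * Real.log y + (p * y - x) := by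
  have h := Real.log_le_sub_one_of_pos (show 0 < p * y / x by positivity)
  rw [Real.log_div (by positivity) hx.ne', Real.log_mul hp.ne' hy.ne'] at h
  have h2 := mul_le_mul_of_nonneg_left h hx.le
  have h3 : x * (p * y / x - 1) = p * y - x := by field_simp
  linarith

/-- The likelihood of a binary sequence with `k` ones and `j` zeros exceeds its Krichevsky–Trofimov
probability by at most the factor of the constant sequence. -/
theorem pow_mul_pow_mul_halfRising_le {p q : ℝ} (hp : 0 ≤ p) (hq : 0 ≤ q) (hpq : p + q = 1)
    (k j : ℕ) : p ^ k * q ^ j * halfRising (k + j) ≤ halfRising k * halfRising j := by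
  have hk := halfRising_pos k
  have hj := halfRising_pos j
  have hkj := halfRising_pos (k + j)
  rcases Nat.eq_zero_or_pos k with rfl | k0
  · simpa [halfRising_zero] using
      mul_le_mul_of_nonneg_right (pow_le_one₀ (n := j) hq (by linarith)) hj.le
  rcases Nat.eq_zero_or_pos j with rfl | j0
  · simpa [halfRising_zero] using
      mul_le_mul_of_nonneg_right (pow_le_one₀ (n := k) hp (by linarith)) hk.le
  rcases hp.eq_or_lt with rfl | hp
  · rw [zero_pow k0.ne']; simp only [zero_mul]; positivity
  rcases hq.eq_or_lt with rfl | hq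
  · rw [zero_pow j0.ne']; simp only [zero_mul, mul_zero]; positivity
  have k0' : (0 : ℝ) < k := by exact_mod_cast k0
  have j0' : (0 : ℝ) < j := by exact_mod_cast j0
  rw [← Real.log_le_log_iff (by positivity) (by positivity), Real.log_mul (by positivity) hkj.ne',
    Real.log_mul (by positivity) (by positivity), Real.log_pow, Real.log_pow,
    Real.log_mul hk.ne' hj.ne']
  -- The likelihood is compared with its maximum at `p = k / (k + j)`; by `h4` the two linear
  -- corrections cancel.
  have h1 := mul_log_le_mul_log_sub hp k0' (add_pos k0' j0')
  have h2 := mul_log_le_mul_log_sub hq j0' (add_pos k0' j0')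
  have h3 := log_halfRising_add_le k j
  have h4 : p * ((k : ℝ) + j) + q * (k + j) = k + j := by rw [← add_mul, hpq, one_mul]
  linarith

/-- The Krichevsky–Trofimov probability of a binary sequence with `k` ones and `j` zeros. -/
noncomputable def ktProb (k j : ℕ) : ℝ := halfRising k * halfRising j / (k + j).factorial

theorem ktProb_pos (k j : ℕ) : 0 < ktProb k j := by
  have hk := halfRising_pos k
  have hj := halfRising_pos j
  unfold ktProb; positivity

/-- Consistency of the probabilities under extension of the sequence by one bit, which makes the
mixture wealth a supermartingale. -/
theorem ktProb_succ_add (k j : ℕ) : ktProb (k + 1) j + ktProb k (j + 1) = ktProb k j := by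
  unfold ktProb
  rw [show k + 1 + j = k + j + 1 by ring, show k + (j + 1) = k + j + 1 by ring, halfRising_succ,
    halfRising_succ, Nat.factorial_succ]
  have : ((k + j).factorial : ℝ) ≠ 0 := by positivity
  push_cast
  field_simp
  ring

/-! ### The mixture wealth and its comparison with single bets -/

/-- The payoff of a bet on `1` (`b = true`) or on `0` (`b = false`). -/
def sidePayoff (b : Bool) (c : ℝ) : ℝ := if b then c else 1 - c

theorem sidePayoff_nonneg (b : Bool) {c : ℝ} (hc : c ∈ Set.Icc (0 : ℝ) 1) :
    0 ≤ sidePayoff b c := by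
  cases b <;> simp [sidePayoff, hc.1, hc.2]

theorem measurable_sidePayoff (b : Bool) : Measurable (sidePayoff b) := by
  cases b
  · simpa [sidePayoff] using! measurable_const.sub measurable_id
  · simpa [sidePayoff] using! measurable_id

theorem payoff_eq_sum (w c : ℝ) : payoff w c = ∑ b, sidePayoff b w * sidePayoff b c := by
  simp [payoff, sidePayoff, add_comm]

/-- The number of entries `true`. -/
def numTrue {n : ℕ} (b : Fin n → Bool) : ℕ := ∑ i, (b i).toNat

/-- The number of entries `false`. -/
def numFalse {n : ℕ} (b : Fin n → Bool) : ℕ := ∑ i, (!b i).toNat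

theorem numTrue_add_numFalse {n : ℕ} (b : Fin n → Bool) : numTrue b + numFalse b = n := by
  rw [numTrue, numFalse, ← Finset.sum_add_distrib]
  have : ∀ a : Bool, a.toNat + (!a).toNat = 1 := by decide
  simp [this]

theorem prod_eq_pow_numTrue_mul_pow_numFalse {M : Type*} [CommMonoid M] {n : ℕ}
    (b : Fin n → Bool) (g : Bool → M) :
    ∏ i, g (b i) = g true ^ numTrue b * g false ^ numFalse b := by
  rw [numTrue, numFalse, ← Finset.prod_pow_eq_pow_sum, ← Finset.prod_pow_eq_pow_sum,
    ← Finset.prod_mul_distrib]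
  refine Finset.prod_congr rfl fun i _ => ?_
  cases b i <;> simp

/-- The wealth of the Krichevsky–Trofimov mixture of the bets that are fair under mean `m`. -/
noncomputable def mixtureWealth {n : ℕ} (c : Fin n → ℝ) (m : ℝ) : ℝ≥0∞ :=
  ∑ b : Fin n → Bool, ENNReal.ofReal (ktProb (numTrue b) (numFalse b)) *
    ∏ i, (ENNReal.ofReal (sidePayoff (b i) (c i)) / ENNReal.ofReal (sidePayoff (b i) m))

theorem mixtureWealth_zero (c : Fin 0 → ℝ) (m : ℝ) : mixtureWealth c m = 1 := by
  simp [mixtureWealth, numTrue, numFalse, ktProb, halfRising_zero]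

theorem mixtureWealth_snoc {n : ℕ} (c : Fin n → ℝ) (y m : ℝ) :
    mixtureWealth (Fin.snoc c y : Fin (n + 1) → ℝ) m = ∑ b : Fin n → Bool, ∑ a : Bool,
      ENNReal.ofReal (ktProb (numTrue b + a.toNat) (numFalse b + (!a).toNat)) *
        (∏ i, (ENNReal.ofReal (sidePayoff (b i) (c i)) / ENNReal.ofReal (sidePayoff (b i) m))) *
          (ENNReal.ofReal (sidePayoff a y) / ENNReal.ofReal (sidePayoff a m)) := by
  unfold mixtureWealth
  rw [← (Fin.snocEquiv fun _ : Fin (n + 1) => Bool).sum_comp, Fintype.sum_prod_type,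
    Finset.sum_comm]
  refine Finset.sum_congr rfl fun b _ => Finset.sum_congr rfl fun a _ => ?_
  simp [Fin.prod_univ_castSucc, numTrue, numFalse, Fin.sum_univ_castSucc, Fin.snocEquiv, mul_assoc]

/-- The supermartingale step: the new factor averages to at most 1 for either bit, and the
probabilities of the two extensions add up to that of the old sequence. -/
theorem lintegral_mixtureWealth_snoc_le {α : Type*} [MeasurableSpace α] {ρ : Measure α}
    {g : α → ℝ} (hg : Measurable g) {m : ℝ}
    (h : ∀ a, ∫⁻ y, ENNReal.ofReal (sidePayoff a (g y)) / ENNReal.ofReal (sidePayoff a m) ∂ρ ≤ 1)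
    {n : ℕ} (c : Fin n → ℝ) :
    ∫⁻ y, mixtureWealth (Fin.snoc c (g y) : Fin (n + 1) → ℝ) m ∂ρ ≤ mixtureWealth c m := by
  have hmeas : ∀ a, Measurable fun y =>
      ENNReal.ofReal (sidePayoff a (g y)) / ENNReal.ofReal (sidePayoff a m) := fun a =>
    (ENNReal.measurable_ofReal.comp ((measurable_sidePayoff a).comp hg)).div_const _
  simp only [mixtureWealth_snoc]
  rw [lintegral_finsetSum _ fun b _ => Finset.measurable_fun_sum _ fun a _ =>
    (hmeas a).const_mul _]
  refine Finset.sum_le_sum fun b _ => ?_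
  rw [lintegral_finsetSum _ fun a _ => (hmeas a).const_mul _]
  simp_rw [lintegral_const_mul _ (hmeas _)]
  refine (Finset.sum_le_sum fun a _ => mul_le_of_le_one_right' (h a)).trans (le_of_eq ?_)
  rw [← Finset.sum_mul, Fintype.sum_bool, ← ENNReal.ofReal_add (ktProb_pos _ _).le
    (ktProb_pos _ _).le]
  simp [ktProb_succ_add]

/-- Expand the product over binary sequences and compare term by term; each comparison is the regret
bound for a binary sequence. In `ℝ≥0∞` this covers `m ∈ {0, 1}` too. -/
theorem ofReal_prod_payoff_div_le_mixtureWealth {n : ℕ} {c : Fin n → ℝ}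
    (hc : ∀ i, c i ∈ Set.Icc (0 : ℝ) 1) {m : ℝ} (hm : m ∈ Set.Icc (0 : ℝ) 1) {w : ℝ}
    (hw : w ∈ Set.Ioo (0 : ℝ) 1) :
    ENNReal.ofReal ((∏ i, payoff w (c i)) / payoff w m ^ n) ≤
      ENNReal.ofReal (n.factorial / halfRising n) * mixtureWealth c m := by
  have hd := payoff_pos hw hm
  have hw' : w ∈ Set.Icc (0 : ℝ) 1 := Set.Ioo_subset_Icc_self hw
  have hnn : ∀ (b : Bool) i, 0 ≤ sidePayoff b (c i) := fun b i => sidePayoff_nonneg b (hc i)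
  have hprod : ∏ i, payoff w (c i) = ∑ b : Fin n → Bool,
      (∏ i, sidePayoff (b i) w) * ∏ i, sidePayoff (b i) (c i) := by
    simp_rw [payoff_eq_sum, ← Finset.prod_mul_distrib]
    rw [Finset.prod_univ_sum, Fintype.piFinset_univ]
  rw [hprod, Finset.sum_div, mixtureWealth, Finset.mul_sum, ENNReal.ofReal_sum_of_nonneg
    fun b _ => div_nonneg (mul_nonneg (Finset.prod_nonneg fun i _ => sidePayoff_nonneg _ hw')
      (Finset.prod_nonneg fun i _ => hnn _ i)) (by positivity)]
  refine Finset.sum_le_sum fun b _ => ?_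
  set k := numTrue b with hk
  set j := numFalse b with hj
  have hkj : k + j = n := numTrue_add_numFalse b
  rw [prod_eq_pow_numTrue_mul_pow_numFalse b fun a => sidePayoff a w]
  simp_rw [ENNReal.div_eq_inv_mul]
  rw [Finset.prod_mul_distrib,
    prod_eq_pow_numTrue_mul_pow_numFalse b fun a => (ENNReal.ofReal (sidePayoff a m))⁻¹,
    ← hk, ← hj, ← ENNReal.ofReal_prod_of_nonneg fun i _ => hnn _ i]
  have hkt : (0 : ℝ) < n.factorial / halfRising n * ktProb k j :=
    mul_pos (by have := halfRising_pos n; positivity) (ktProb_pos k j)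
  have hmain : ENNReal.ofReal (sidePayoff true w ^ k * sidePayoff false w ^ j / payoff w m ^ n) ≤
      ENNReal.ofReal (n.factorial / halfRising n * ktProb k j) *
        ((ENNReal.ofReal (sidePayoff true m))⁻¹ ^ k *
          (ENNReal.ofReal (sidePayoff false m))⁻¹ ^ j) := by
    rw [← ENNReal.inv_pow, ← ENNReal.inv_pow, ← ENNReal.mul_inv (by simp) (by simp),
      ← div_eq_mul_inv, ENNReal.le_div_iff_mul_le (Or.inr (by simpa using hkt)) (by simp),
      ← ENNReal.ofReal_pow (sidePayoff_nonneg _ hm), ← ENNReal.ofReal_pow (sidePayoff_nonneg _ hm),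
      ← ENNReal.ofReal_mul (pow_nonneg (sidePayoff_nonneg _ hm) _), ← ENNReal.ofReal_mul
        (div_nonneg (mul_nonneg (pow_nonneg (sidePayoff_nonneg _ hw') _)
          (pow_nonneg (sidePayoff_nonneg _ hw') _)) (by positivity))]
    apply ENNReal.ofReal_le_ofReal
    -- The fractions of capital that the bet of weight `w` places on the outcomes 1 and 0; they are
    -- the `p` and `q` of the regret bound.
    have hpq : sidePayoff true w * sidePayoff true m / payoff w m +
        sidePayoff false w * sidePayoff false m / payoff w m = 1 := by
      rw [← add_div, payoff_eq_sum, Fintype.sum_bool, div_self]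
      rw [payoff_eq_sum, Fintype.sum_bool] at hd
      exact hd.ne'
    have h := pow_mul_pow_mul_halfRising_le
      (div_nonneg (mul_nonneg (sidePayoff_nonneg true hw') (sidePayoff_nonneg true hm)) hd.le)
      (div_nonneg (mul_nonneg (sidePayoff_nonneg false hw') (sidePayoff_nonneg false hm)) hd.le)
      hpq k j
    rw [hkj, ← le_div_iff₀ (halfRising_pos n)] at h
    refine le_of_eq_of_le ?_ (h.trans (le_of_eq ?_))
    · rw [← hkj, div_pow, div_pow, mul_pow, mul_pow, pow_add]
      field_simp
    · have : (n.factorial : ℝ) ≠ 0 := by positivity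
      have := halfRising_pos n
      unfold ktProb
      rw [hkj]
      field_simp
  rw [ENNReal.ofReal_mul (div_pos (by positivity) (halfRising_pos n)).le] at hmain
  calc _ = ENNReal.ofReal (sidePayoff true w ^ k * sidePayoff false w ^ j / payoff w m ^ n) *
        ENNReal.ofReal (∏ i, sidePayoff (b i) (c i)) := by
        rw [← ENNReal.ofReal_mul (div_nonneg (mul_nonneg (pow_nonneg (sidePayoff_nonneg _ hw') _)
          (pow_nonneg (sidePayoff_nonneg _ hw') _)) (by positivity))]
        congr 1
        ring
    _ ≤ _ := mul_le_mul_left hmain _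
    _ = _ := by simp only [mul_assoc, mul_comm, mul_left_comm]

theorem exp_logGain {n : ℕ} {c : Fin n → ℝ} (hc : ∀ i, c i ∈ Set.Icc (0 : ℝ) 1) {m : ℝ}
    (hm : m ∈ Set.Icc (0 : ℝ) 1) {w : ℝ} (hw : w ∈ Set.Ioo (0 : ℝ) 1) :
    Real.exp (logGain c w m) = (∏ i, payoff w (c i)) / payoff w m ^ n := by
  rw [logGain, Real.exp_sub, Real.exp_sum, Real.exp_nat_mul, Real.exp_log (payoff_pos hw hm)]
  simp only [Real.exp_log (payoff_pos hw (hc _))]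

theorem toENNReal_optLogWealth_le_log_mixtureWealth {n : ℕ} {c : Fin n → ℝ}
    (hc : ∀ i, c i ∈ Set.Icc (0 : ℝ) 1) {m : ℝ} (hm : m ∈ Set.Icc (0 : ℝ) 1)
    (h : mixtureWealth c m ≠ ∞) :
    1 ≤ n.factorial / halfRising n * (mixtureWealth c m).toReal ∧
      (optLogWealth c m).toENNReal ≤
        ENNReal.ofReal (Real.log (n.factorial / halfRising n * (mixtureWealth c m).toReal)) := by
  have key : ∀ w ∈ Set.Ioo (0 : ℝ) 1, Real.exp (logGain c w m) ≤
      n.factorial / halfRising n * (mixtureWealth c m).toReal := by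
    intro w hw
    have hR : (0 : ℝ) ≤ n.factorial / halfRising n :=
      (div_pos (by positivity) (halfRising_pos n)).le
    rw [exp_logGain hc hm hw, ← ENNReal.ofReal_le_ofReal_iff (by positivity),
      ENNReal.ofReal_mul hR, ENNReal.ofReal_toReal h]
    exact ofReal_prod_payoff_div_le_mixtureWealth hc hm hw
  -- Weight `1/2` keeps wealth 1, so the logarithm below is nonnegative.
  have h1 : 1 ≤ n.factorial / halfRising n * (mixtureWealth c m).toReal := by
    have := key (1 / 2) one_half_mem_rationalWeights.1
    rwa [logGain_one_half, Real.exp_zero] at this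
  refine ⟨h1, ?_⟩
  rw [toENNReal_optLogWealth hc hm]
  exact iSup₂_le fun w hw => ENNReal.ofReal_le_ofReal
    ((Real.le_log_iff_exp_le (by linarith)).2 (key w hw.1))

/-! ### Ville's inequality -/

section Ville

variable {Ω 𝒳 : Type*} [MeasurableSpace Ω] [MeasurableSpace 𝒳] {μ : Measure Ω}
  [IsProbabilityMeasure μ] {X : ℕ → Ω → 𝒳} {G : ∀ n, (Fin n → 𝒳) → ℝ≥0∞}

/-- A functional of the first `n + 1` data points whose average over the last point is at most the
functional of the first `n` points has smaller integrals on events of the first `n` points. -/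
theorem setLIntegral_succ_le_of_iid (hX : ∀ i, Measurable (X i)) (hindep : iIndepFun X μ)
    (hident : ∀ i, IdentDistrib (X i) (X 0) μ μ) (hG : ∀ n, Measurable (G n))
    (hstep : ∀ n x, ∫⁻ y, G (n + 1) (Fin.snoc x y : Fin (n + 1) → 𝒳) ∂(μ.map (X 0)) ≤ G n x)
    {n : ℕ} {A : Set (Fin n → 𝒳)} (hA : MeasurableSet A) :
    ∫⁻ ω in {ω | (fun i : Fin n => X i ω) ∈ A}, G (n + 1) (fun i => X i ω) ∂μ ≤
      ∫⁻ ω in {ω | (fun i : Fin n => X i ω) ∈ A}, G n (fun i => X i ω) ∂μ := by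
  set V : Ω → Fin n → 𝒳 := fun ω i => X i ω with hV
  have hVm : Measurable V := measurable_pi_lambda _ fun i => hX i
  have hAm : MeasurableSet {ω | V ω ∈ A} := hVm hA
  have hind : IndepFun V (X n) μ := by
    have h := hindep.indepFun_finset (Finset.range n) {n} (by simp) hX
    have hlast : Measurable fun z : ({n} : Finset ℕ) → 𝒳 => z ⟨n, Finset.mem_singleton_self n⟩ :=
      measurable_pi_apply _
    have hfst : Measurable fun (z : Finset.range n → 𝒳) (i : Fin n) =>
        z ⟨i, Finset.mem_range.2 i.2⟩ := measurable_pi_lambda _ fun i => measurable_pi_apply _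
    exact h.comp hfst hlast
  have hsnoc : Measurable fun z : (Fin n → 𝒳) × 𝒳 => (Fin.snoc z.1 z.2 : Fin (n + 1) → 𝒳) := by
    refine measurable_pi_lambda _ fun i => ?_
    refine Fin.lastCases ?_ (fun i => ?_) i
    · simpa using measurable_snd
    · simp only [Fin.snoc_castSucc]
      exact (measurable_pi_apply i).comp measurable_fst
  have hGs : Measurable fun z : (Fin n → 𝒳) × 𝒳 => G (n + 1) (Fin.snoc z.1 z.2) :=
    (hG _).comp hsnoc
  have hind1 : Measurable fun z : (Fin n → 𝒳) × 𝒳 => A.indicator (fun _ => (1 : ℝ≥0∞)) z.1 :=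
    (measurable_const.indicator hA).comp measurable_fst
  have hlaw : μ.map (fun ω => (V ω, X n ω)) = (μ.map V).prod (μ.map (X 0)) := by
    rw [(indepFun_iff_map_prod_eq_prod_map_map hVm.aemeasurable (hX n).aemeasurable).1 hind,
      (hident n).map_eq]
  have : IsProbabilityMeasure (μ.map (X 0)) := Measure.isProbabilityMeasure_map (hX 0).aemeasurable
  have hpre : ∀ ω, (fun i : Fin (n + 1) => X i ω) = Fin.snoc (V ω) (X n ω) := by
    intro ω
    funext i
    refine Fin.lastCases ?_ (fun i => ?_) i <;> simp [hV]
  calc ∫⁻ ω in {ω | V ω ∈ A}, G (n + 1) (fun i => X i ω) ∂μ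
      = ∫⁻ ω, A.indicator (fun _ => 1) (V ω) * G (n + 1) (Fin.snoc (V ω) (X n ω)) ∂μ := by
        rw [← lintegral_indicator hAm]
        refine lintegral_congr fun ω => ?_
        by_cases h : V ω ∈ A <;> simp [Set.indicator, h, hpre]
    _ = ∫⁻ z, A.indicator (fun _ => 1) z.1 * G (n + 1) (Fin.snoc z.1 z.2)
          ∂(μ.map fun ω => (V ω, X n ω)) :=
        (lintegral_map (hind1.mul hGs) (hVm.prodMk (hX n))).symm
    _ = ∫⁻ x, A.indicator (fun _ => 1) x * ∫⁻ y, G (n + 1) (Fin.snoc x y : Fin (n + 1) → 𝒳)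
          ∂(μ.map (X 0)) ∂(μ.map V) := by
        rw [hlaw]
        refine (lintegral_prod _ (hind1.mul hGs).aemeasurable).trans ?_
        refine lintegral_congr fun x => ?_
        have hGx : Measurable fun y => G (n + 1) (Fin.snoc x y : Fin (n + 1) → 𝒳) :=
          hGs.comp measurable_prodMk_left
        exact lintegral_const_mul (A.indicator (fun _ => 1) x) hGx
    _ ≤ ∫⁻ x, A.indicator (fun _ => 1) x * G n x ∂(μ.map V) :=
        lintegral_mono fun x => mul_le_mul_right (hstep n x) _
    _ = ∫⁻ ω, A.indicator (fun _ => 1) (V ω) * G n (V ω) ∂μ :=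
        lintegral_map ((measurable_const.indicator hA).mul (hG n)) hVm
    _ = ∫⁻ ω in {ω | V ω ∈ A}, G n (V ω) ∂μ := by
        rw [← lintegral_indicator hAm]
        refine lintegral_congr fun ω => ?_
        by_cases h : V ω ∈ A <;> simp [Set.indicator, h]

/-- Ville's inequality for functionals of i.i.d. data. -/
theorem mul_measure_exists_le_le_one (hX : ∀ i, Measurable (X i)) (hindep : iIndepFun X μ)
    (hident : ∀ i, IdentDistrib (X i) (X 0) μ μ) (hG : ∀ n, Measurable (G n))
    (hstep : ∀ n x, ∫⁻ y, G (n + 1) (Fin.snoc x y : Fin (n + 1) → 𝒳) ∂(μ.map (X 0)) ≤ G n x)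
    (hG0 : ∀ x, G 0 x ≤ 1) (t : ℝ≥0∞) :
    t * μ {ω | ∃ n, t ≤ G n fun i => X i ω} ≤ 1 := by
  set F : ℕ → Ω → ℝ≥0∞ := fun n ω => G n fun i => X i ω with hF
  have hFm : ∀ n, Measurable (F n) := fun n =>
    (hG n).comp (measurable_pi_lambda _ fun i => hX i)
  set H : ℕ → Set Ω := fun n => {ω | ∃ k < n, t ≤ F k ω} with hH
  have hHm : ∀ n, MeasurableSet (H n) := by
    intro n
    have : H n = ⋃ k, ⋃ _ : k < n, {ω | t ≤ F k ω} := by ext; simp [hH]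
    rw [this]
    exact MeasurableSet.iUnion fun k => MeasurableSet.iUnion fun _ =>
      measurableSet_le measurable_const (hFm k)
  have hHsucc : ∀ n, H (n + 1) = H n ∪ {ω | t ≤ F n ω} := by
    intro n
    ext ω
    simp only [hH, Set.mem_ofPred_eq, Set.mem_union, Nat.lt_succ_iff_lt_or_eq, or_and_right,
      exists_or, exists_eq_left]
  -- Not having crossed at times `0, …, n` is an event of the first `n` points, so the
  -- supermartingale step applies on it.
  have hdecr : ∀ n, ∫⁻ ω in (H (n + 1))ᶜ, F (n + 1) ω ∂μ ≤ ∫⁻ ω in (H (n + 1))ᶜ, F n ω ∂μ := by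
    intro n
    set A : Set (Fin n → 𝒳) := {x | ∀ k, ∀ h : k ≤ n, ¬ t ≤ G k fun i => x (Fin.castLE h i)}
    have hA : MeasurableSet A := by
      have : A = ⋂ k, ⋂ h : k ≤ n, {x | t ≤ G k fun i => x (Fin.castLE h i)}ᶜ := by
        ext; simp [A]
      rw [this]
      refine MeasurableSet.iInter fun k => MeasurableSet.iInter fun h =>
        (measurableSet_le measurable_const ((hG k).comp ?_)).compl
      exact measurable_pi_lambda _ fun i => measurable_pi_apply _
    have hHA : (H (n + 1))ᶜ = {ω | (fun i : Fin n => X i ω) ∈ A} := by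
      ext ω
      simp [hH, hF, A]
    rw [hHA]
    exact setLIntegral_succ_le_of_iid hX hindep hident hG hstep hA
  -- The stopped process, with its value replaced by `t` once the level has been crossed, keeps
  -- expectation at most 1.
  have hind : ∀ n, t * μ (H n) + ∫⁻ ω in (H n)ᶜ, F n ω ∂μ ≤ 1 := by
    intro n
    induction n with
    | zero =>
      have : H 0 = ∅ := by ext; simp [hH]
      rw [this]
      simp only [measure_empty, mul_zero, zero_add, Set.compl_empty, Measure.restrict_univ]
      calc ∫⁻ ω, F 0 ω ∂μ ≤ ∫⁻ _, 1 ∂μ := lintegral_mono fun ω => hG0 _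
        _ = 1 := by simp
    | succ n ih =>
      refine le_trans ?_ ih
      set D : Set Ω := {ω | t ≤ F n ω}
      have hD : MeasurableSet D := measurableSet_le measurable_const (hFm n)
      have hsplit := lintegral_inter_add_sdiff (μ := μ) (F n) (H n)ᶜ hD
      have hdiff : (H n)ᶜ \ D = (H (n + 1))ᶜ := by
        rw [hHsucc, Set.compl_union, Set.sdiff_eq]
      have hmeas : μ (H (n + 1)) ≤ μ (H n) + μ ((H n)ᶜ ∩ D) := by
        refine le_trans (measure_mono ?_) (measure_union_le _ _)
        rw [hHsucc]
        intro ω hω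
        by_cases h : ω ∈ H n
        · exact Or.inl h
        · exact Or.inr ⟨h, hω.resolve_left h⟩
      have hlow : t * μ ((H n)ᶜ ∩ D) ≤ ∫⁻ ω in (H n)ᶜ ∩ D, F n ω ∂μ := by
        rw [← setLIntegral_const]
        exact setLIntegral_mono (hFm n) fun ω hω => hω.2
      rw [← hsplit, hdiff, ← add_assoc]
      refine add_le_add ?_ (hdecr n)
      calc t * μ (H (n + 1)) ≤ t * (μ (H n) + μ ((H n)ᶜ ∩ D)) := by gcongr
        _ = t * μ (H n) + t * μ ((H n)ᶜ ∩ D) := mul_add _ _ _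
        _ ≤ _ := by gcongr
  have hunion : {ω | ∃ n, t ≤ G n fun i => X i ω} = ⋃ n, H n := by
    ext ω
    simp only [Set.mem_ofPred_eq, Set.mem_iUnion, hH]
    exact ⟨fun ⟨n, h⟩ => ⟨n + 1, n, n.lt_succ_self, h⟩, fun ⟨_, k, _, h⟩ => ⟨k, h⟩⟩
  have hmono : Monotone H := fun a b hab ω ⟨k, hk, h⟩ => ⟨k, hk.trans_le hab, h⟩
  rw [hunion, hmono.measure_iUnion, ENNReal.mul_iSup]
  exact iSup_le fun n => le_self_add.trans (hind n)

end Ville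

/-! ### Change of measure -/

section ChangeOfMeasure

/-- After cancellation this is the Fenchel–Young inequality `r log z ≤ r log r - r + z` at `z = M /
L`. -/
theorem mul_log_add_one_le_klFun {r R L M : ℝ} (hr : 0 ≤ r) (hR : 0 < R) (hL : 0 < L)
    (hM : 0 < M) :
    r * Real.log (R * M) + 1 ≤
      InformationTheory.klFun r + r * (Real.log R + Real.log L) + M * (1 / L) := by
  rw [InformationTheory.klFun_apply, Real.log_mul hR.ne' hM.ne']
  have h0 : 0 < M * (1 / L) := by positivity
  rcases hr.eq_or_lt with rfl | hr
  · simp only [zero_mul]; linarith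
  · have h := mul_log_le_mul_log_sub (p := M * (1 / L) / r) (x := r) (y := r)
      (by positivity) hr hr
    rw [Real.log_div h0.ne' hr.ne', Real.log_mul hM.ne' (by positivity), one_div L, Real.log_inv,
      ← one_div L, div_mul_cancel₀ _ hr.ne'] at h
    linarith

/-- The Donsker–Varadhan change of measure, for an exponential moment bounded by `R * L`. -/
theorem lintegral_le_klDiv_add_log {α : Type*} [MeasurableSpace α] {P Q : Measure α}
    [IsProbabilityMeasure P] [IsProbabilityMeasure Q] {g M : α → ℝ≥0∞} (hg : Measurable g)
    (hM : Measurable M) {R L : ℝ} (hR : 1 ≤ R) (hL : 1 ≤ L)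
    (hgM : ∀ a, M a ≠ ∞ → 1 ≤ R * (M a).toReal ∧ g a ≤ ENNReal.ofReal (Real.log (R * (M a).toReal)))
    (hint : ∫⁻ a, M a ∂P ≤ ENNReal.ofReal L) :
    ∫⁻ a, g a ∂Q ≤ InformationTheory.klDiv Q P + ENNReal.ofReal (Real.log R + Real.log L) := by
  by_cases hac : Q ≪ P
  swap
  · rw [InformationTheory.klDiv_of_not_ac hac]; simp
  have hR0 : 0 < R := by linarith
  have hL0 : 0 < L := by linarith
  have hC : 0 ≤ Real.log R + Real.log L := add_nonneg (Real.log_nonneg hR) (Real.log_nonneg hL)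
  rw [InformationTheory.klDiv_eq_lintegral_klFun_of_ac hac, ← lintegral_rnDeriv_mul hac
    hg.aemeasurable]
  have hr := Q.measurable_rnDeriv P
  have hk : Measurable fun a => ENNReal.ofReal (InformationTheory.klFun (Q.rnDeriv P a).toReal) :=
    ENNReal.measurable_ofReal.comp
      (InformationTheory.measurable_klFun.comp hr.ennreal_toReal)
  -- The added 1 avoids subtraction in `ℝ≥0∞`; after integration it cancels against `∫ M / L ≤ 1`.
  have hpt : ∀ᵐ a ∂P, Q.rnDeriv P a * g a + 1 ≤
      ENNReal.ofReal (InformationTheory.klFun (Q.rnDeriv P a).toReal) +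
        Q.rnDeriv P a * ENNReal.ofReal (Real.log R + Real.log L) +
          M a * ENNReal.ofReal (1 / L) := by
    filter_upwards [Q.rnDeriv_lt_top P] with a ha
    by_cases hMa : M a = ∞
    · rw [hMa, ENNReal.top_mul (by simpa using hL0)]
      simp
    obtain ⟨h1, h2⟩ := hgM a hMa
    have hM0 : 0 < (M a).toReal := by
      by_contra h
      nlinarith [ENNReal.toReal_nonneg (a := M a)]
    have hreal := mul_log_add_one_le_klFun (ENNReal.toReal_nonneg (a := Q.rnDeriv P a)) hR0 hL0 hM0
    have hkn := InformationTheory.klFun_nonneg (ENNReal.toReal_nonneg (a := Q.rnDeriv P a))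
    have hlog := Real.log_nonneg h1
    calc Q.rnDeriv P a * g a + 1
        ≤ Q.rnDeriv P a * ENNReal.ofReal (Real.log (R * (M a).toReal)) + 1 := by gcongr
      _ = ENNReal.ofReal ((Q.rnDeriv P a).toReal * Real.log (R * (M a).toReal) + 1) := by
          rw [ENNReal.ofReal_add (by positivity) zero_le_one,
            ENNReal.ofReal_mul ENNReal.toReal_nonneg, ENNReal.ofReal_toReal ha.ne,
            ENNReal.ofReal_one]
      _ ≤ _ := ENNReal.ofReal_le_ofReal hreal
      _ = _ := by
          rw [ENNReal.ofReal_add (by positivity) (by positivity),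
            ENNReal.ofReal_add hkn (by positivity),
            ENNReal.ofReal_mul ENNReal.toReal_nonneg, ENNReal.ofReal_mul ENNReal.toReal_nonneg,
            ENNReal.ofReal_toReal ha.ne, ENNReal.ofReal_toReal hMa]
  have h := lintegral_mono_ae hpt
  rw [lintegral_add_right _ measurable_const, lintegral_add_right _ (hM.mul_const _),
    lintegral_add_left hk, lintegral_mul_const _ hr, lintegral_mul_const _ hM,
    Measure.lintegral_rnDeriv hac] at h
  simp only [measure_univ, lintegral_const, one_mul] at h
  have hlast : (∫⁻ a, M a ∂P) * ENNReal.ofReal (1 / L) ≤ 1 := by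
    calc _ ≤ ENNReal.ofReal L * ENNReal.ofReal (1 / L) := by gcongr
      _ = 1 := by
        rw [← ENNReal.ofReal_mul hL0.le, mul_one_div_cancel hL0.ne', ENNReal.ofReal_one]
  exact (ENNReal.add_le_add_iff_right ENNReal.one_ne_top).1 (h.trans (by gcongr))

end ChangeOfMeasure

/-! ### Existence of optimizers -/

/-- A continuous linear functional attains its maximum on a nonempty bounded closed convex set of a
Hilbert space. -/
theorem exists_forall_apply_le_of_isClosed_convex_bounded {F : Type*} [NormedAddCommGroup F]
    [InnerProductSpace ℝ F] [CompleteSpace F] {K : Set F} (hne : K.Nonempty) (hcl : IsClosed K)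
    (hconv : Convex ℝ K) {B : ℝ} (hB : ∀ u ∈ K, ‖u‖ ≤ B) (φ : F →L[ℝ] ℝ) :
    ∃ u ∈ K, ∀ v ∈ K, φ v ≤ φ u := by
  have hbdd : BddAbove (φ '' K) := by
    refine ⟨‖φ‖ * B, ?_⟩
    rintro _ ⟨u, hu, rfl⟩
    calc φ u ≤ ‖φ u‖ := Real.le_norm_self _
      _ ≤ ‖φ‖ * ‖u‖ := φ.le_opNorm u
      _ ≤ ‖φ‖ * B := by gcongr; exact hB u hu
  set s := sSup (φ '' K) with hs
  set C : ℕ → Set F := fun k => K ∩ {u | s - 1 / ((k : ℝ) + 1) ≤ φ u} with hC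
  have hCcl : ∀ k, IsClosed (C k) := fun k =>
    hcl.inter (isClosed_le continuous_const φ.continuous)
  have hCconv : ∀ k, Convex ℝ (C k) := fun k =>
    hconv.inter (convex_halfSpace_ge φ.toLinearMap.isLinear _)
  have hCne : ∀ k, (C k).Nonempty := by
    intro k
    obtain ⟨_, ⟨u, hu, rfl⟩, h⟩ := exists_lt_of_lt_csSup (hne.image φ)
      (sub_lt_self s (by positivity : 0 < 1 / ((k : ℝ) + 1)))
    exact ⟨u, hu, h.le⟩
  have hCanti : ∀ {k l}, k ≤ l → C l ⊆ C k := by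
    intro k l hkl u ⟨hu, h⟩
    refine ⟨hu, (?_ : s - 1 / ((k : ℝ) + 1) ≤ φ u)⟩
    refine le_trans ?_ (show s - 1 / ((l : ℝ) + 1) ≤ φ u from h)
    have : (k : ℝ) ≤ l := by exact_mod_cast hkl
    gcongr
  -- In place of weak compactness: the points of least norm in the shrinking superlevel slices have
  -- increasing bounded norms, so the parallelogram law makes them Cauchy. Their limit lies in every
  -- slice.
  have hmin : ∀ k, ∃ u ∈ C k, ∀ v ∈ C k, ‖u‖ ≤ ‖v‖ := by
    intro k
    obtain ⟨u, hu, h⟩ := exists_norm_eq_iInf_of_complete_convex (hCne k) (hCcl k).isComplete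
      (hCconv k) 0
    refine ⟨u, hu, fun v hv => ?_⟩
    have hbd : BddBelow (Set.range fun w : C k => ‖(0 : F) - w‖) :=
      ⟨0, by rintro _ ⟨w, rfl⟩; exact norm_nonneg _⟩
    have := ciInf_le hbd ⟨v, hv⟩
    rw [← h] at this
    simpa using this
  choose u huC hu using hmin
  have hnorm : Monotone fun k => ‖u k‖ := fun k l hkl => hu k _ (hCanti hkl (huC l))
  have hlim : Tendsto (fun k => ‖u k‖) atTop (𝓝 (⨆ k, ‖u k‖)) :=
    tendsto_atTop_ciSup hnorm ⟨B, by rintro _ ⟨k, rfl⟩; exact hB _ (huC k).1⟩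
  have hpar : ∀ k l, k ≤ l → ‖u k - u l‖ * ‖u k - u l‖ ≤
      2 * (‖u l‖ * ‖u l‖ - ‖u k‖ * ‖u k‖) := by
    intro k l hkl
    have hmid : (1 / 2 : ℝ) • u k + (1 / 2 : ℝ) • u l ∈ C k :=
      hCconv k (huC k) (hCanti hkl (huC l)) (by norm_num) (by norm_num) (by norm_num)
    have h1 := hu k _ hmid
    rw [← smul_add, norm_smul] at h1
    norm_num at h1
    have h2 := parallelogram_law_with_norm ℝ (u k) (u l)
    nlinarith [norm_nonneg (u k)]
  have hcau : CauchySeq u := by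
    rw [Metric.cauchySeq_iff']
    intro ε hε
    have hsq := (hlim.mul hlim).cauchySeq
    obtain ⟨N, hN⟩ := Metric.cauchySeq_iff'.1 hsq (ε * ε / 2) (by positivity)
    refine ⟨N, fun l hl => ?_⟩
    have h1 := hN l hl
    rw [Real.dist_eq] at h1
    have h2 := hpar N l hl
    rw [dist_comm, dist_eq_norm]
    have h3 := le_abs_self (‖u l‖ * ‖u l‖ - ‖u N‖ * ‖u N‖)
    exact lt_of_mul_self_lt_mul_self₀ hε.le (by linarith)
  obtain ⟨v, hv⟩ := cauchySeq_tendsto_of_complete hcau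
  have hvC : ∀ k, v ∈ C k := fun k => (hCcl k).mem_of_tendsto hv
    (eventually_atTop.2 ⟨k, fun l hl => hCanti hl (huC l)⟩)
  refine ⟨v, (hvC 0).1, fun w hw => le_trans (le_csSup hbdd ⟨w, hw, rfl⟩) ?_⟩
  have h0 : Tendsto (fun k : ℕ => s - 1 / ((k : ℝ) + 1)) atTop (𝓝 (s - 0)) :=
    tendsto_const_nhds.sub tendsto_one_div_add_atTop_nhds_zero_nat
  rw [sub_zero] at h0
  exact le_of_tendsto h0 (Eventually.of_forall fun k => (hvC k).2)

/-- Under a convex and lower semicontinuous integral constraint, the integral of a `[0,1]`-valued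
function attains its extreme values. -/
theorem exists_forall_mul_integral_le {α : Type*} [MeasurableSpace α] (Q : Measure α)
    [IsProbabilityMeasure Q] {Ψ : α → ℝ → ℝ≥0∞} (b : ℝ≥0∞)
    (hmeas : ∀ ν : α → ℝ, Measurable ν → (∀ a, ν a ∈ Set.Icc (0 : ℝ) 1) →
      Measurable fun a => Ψ a (ν a))
    (hconv : ∀ a, ∀ u ∈ Set.Icc (0 : ℝ) 1, ∀ v ∈ Set.Icc (0 : ℝ) 1, ∀ s t : ℝ, 0 ≤ s → 0 ≤ t →
      s + t = 1 → Ψ a (s * u + t * v) ≤ ENNReal.ofReal s * Ψ a u + ENNReal.ofReal t * Ψ a v)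
    (hlsc : ∀ a, ∀ u : ℕ → ℝ, (∀ k, u k ∈ Set.Icc (0 : ℝ) 1) → ∀ m, Tendsto u atTop (𝓝 m) →
      Ψ a m ≤ liminf (fun k => Ψ a (u k)) atTop)
    (hne : ∃ ν : α → ℝ, Measurable ν ∧ (∀ a, ν a ∈ Set.Icc (0 : ℝ) 1) ∧ ∫⁻ a, Ψ a (ν a) ∂Q ≤ b)
    (r : ℝ) :
    ∃ ν : α → ℝ, (Measurable ν ∧ (∀ a, ν a ∈ Set.Icc (0 : ℝ) 1) ∧ ∫⁻ a, Ψ a (ν a) ∂Q ≤ b) ∧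
      ∀ ν' : α → ℝ, Measurable ν' → (∀ a, ν' a ∈ Set.Icc (0 : ℝ) 1) → ∫⁻ a, Ψ a (ν' a) ∂Q ≤ b →
        r * ∫ a, ν' a ∂Q ≤ r * ∫ a, ν a ∂Q := by
  set K : Set (Lp ℝ 2 Q) := {u | ∃ ν : α → ℝ, (Measurable ν ∧ (∀ a, ν a ∈ Set.Icc (0 : ℝ) 1) ∧
    ∫⁻ a, Ψ a (ν a) ∂Q ≤ b) ∧ u =ᵐ[Q] ν} with hK
  have hlift : ∀ ν : α → ℝ, Measurable ν → (∀ a, ν a ∈ Set.Icc (0 : ℝ) 1) →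
      ∫⁻ a, Ψ a (ν a) ∂Q ≤ b → ∃ u ∈ K, u =ᵐ[Q] ν := by
    intro ν hν h01 hb
    have hmem : MemLp ν 2 Q := MemLp.of_bound hν.aestronglyMeasurable 1
      (Eventually.of_forall fun a => by
        rw [Real.norm_eq_abs, abs_of_nonneg (h01 a).1]; exact (h01 a).2)
    exact ⟨hmem.toLp ν, ⟨ν, ⟨hν, h01, hb⟩, hmem.coeFn_toLp⟩, hmem.coeFn_toLp⟩
  have hKne : K.Nonempty := by
    obtain ⟨ν, hν, h01, hb⟩ := hne
    obtain ⟨u, hu, -⟩ := hlift ν hν h01 hb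
    exact ⟨u, hu⟩
  have hKbdd : ∀ u ∈ K, ‖u‖ ≤ 1 := by
    rintro u ⟨ν, ⟨-, h01, -⟩, hu⟩
    have h := Lp.norm_le_of_ae_bound (f := u) (C := 1) zero_le_one (by
      filter_upwards [hu] with a ha
      rw [ha, Real.norm_eq_abs, abs_of_nonneg (h01 a).1]; exact (h01 a).2)
    simpa [measureUnivNNReal] using h
  have hKconv : Convex ℝ K := by
    rintro u ⟨ν, ⟨hν, h01, hb⟩, hu⟩ v ⟨ν', ⟨hν', h01', hb'⟩, hv⟩ s t hs ht hst
    refine ⟨fun a => s * ν a + t * ν' a, ⟨(hν.const_mul s).add (hν'.const_mul t),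
      fun a => (convex_Icc (0 : ℝ) 1) (h01 a) (h01' a) hs ht hst, ?_⟩, ?_⟩
    · calc ∫⁻ a, Ψ a (s * ν a + t * ν' a) ∂Q
          ≤ ∫⁻ a, ENNReal.ofReal s * Ψ a (ν a) + ENNReal.ofReal t * Ψ a (ν' a) ∂Q :=
            lintegral_mono fun a => hconv a _ (h01 a) _ (h01' a) s t hs ht hst
        _ = ENNReal.ofReal s * ∫⁻ a, Ψ a (ν a) ∂Q + ENNReal.ofReal t * ∫⁻ a, Ψ a (ν' a) ∂Q := by
            rw [lintegral_add_left ((hmeas ν hν h01).const_mul _),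
              lintegral_const_mul _ (hmeas ν hν h01), lintegral_const_mul _ (hmeas ν' hν' h01')]
        _ ≤ ENNReal.ofReal s * b + ENNReal.ofReal t * b := by gcongr
        _ = b := by rw [← add_mul, ← ENNReal.ofReal_add hs ht, hst, ENNReal.ofReal_one, one_mul]
    · filter_upwards [Lp.coeFn_add (s • u) (t • v), Lp.coeFn_smul s u, Lp.coeFn_smul t v, hu, hv]
        with a h1 h2 h3 h4 h5
      rw [h1, Pi.add_apply, h2, h3, Pi.smul_apply, Pi.smul_apply, h4, h5, smul_eq_mul, smul_eq_mul]
  -- An `L²`-convergent sequence has an a.e. convergent subsequence; semicontinuity and Fatou's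
  -- lemma carry the constraint to the limit.
  have hKcl : IsClosed K := by
    rw [← isSeqClosed_iff_isClosed]
    intro u v hu huv
    choose ν hν huν using hu
    obtain ⟨ns, -, hns⟩ := (tendstoInMeasure_of_tendsto_Lp huv).exists_seq_tendsto_ae
    have hall : ∀ᵐ a ∂Q, Tendsto (fun k => ν (ns k) a) atTop (𝓝 (v a)) := by
      filter_upwards [hns, ae_all_iff.2 huν] with a h1 h2
      simpa only [h2] using h1
    -- The limit takes values in `[0,1]` only almost everywhere; clipping gives a representative
    -- that does so everywhere.
    set w : α → ℝ := fun a => max 0 (min 1 (v a)) with hw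
    have hwm : Measurable w :=
      measurable_const.max (measurable_const.min (Lp.stronglyMeasurable v).measurable)
    have hw01 : ∀ a, w a ∈ Set.Icc (0 : ℝ) 1 := fun a =>
      ⟨le_max_left _ _, max_le zero_le_one (min_le_left _ _)⟩
    have hvw : ∀ᵐ a ∂Q, v a = w a := by
      filter_upwards [hall] with a ha
      have h : v a ∈ Set.Icc (0 : ℝ) 1 :=
        isClosed_Icc.mem_of_tendsto ha (Eventually.of_forall fun k => (hν (ns k)).2.1 a)
      rw [hw]
      simp only
      rw [min_eq_right h.2, max_eq_right h.1]
    refine ⟨w, ⟨hwm, hw01, ?_⟩, hvw⟩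
    calc ∫⁻ a, Ψ a (w a) ∂Q
        ≤ ∫⁻ a, liminf (fun k => Ψ a (ν (ns k) a)) atTop ∂Q := by
          refine lintegral_mono_ae ?_
          filter_upwards [hall, hvw] with a ha hva
          exact hlsc a _ (fun k => (hν (ns k)).2.1 a) _ (hva ▸ ha)
      _ ≤ liminf (fun k => ∫⁻ a, Ψ a (ν (ns k) a) ∂Q) atTop :=
          lintegral_liminf_le fun k => hmeas _ (hν (ns k)).1 (hν (ns k)).2.1
      _ ≤ liminf (fun _ : ℕ => b) atTop :=
          liminf_le_liminf (Eventually.of_forall fun k => (hν (ns k)).2.2)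
      _ = b := liminf_const b
  set φ : Lp ℝ 2 Q →L[ℝ] ℝ := r • innerSL ℝ
    (indicatorConstLp 2 MeasurableSet.univ (measure_ne_top Q Set.univ) (1 : ℝ)) with hφdef
  have hφ : ∀ (u : Lp ℝ 2 Q) (ν : α → ℝ), u =ᵐ[Q] ν → φ u = r * ∫ a, ν a ∂Q := by
    intro u ν h
    have h1 := L2.inner_indicatorConstLp_one (𝕜 := ℝ) MeasurableSet.univ
      (measure_ne_top Q Set.univ) u
    rw [hφdef, smul_apply, innerSL_apply_apply, h1, Measure.restrict_univ,
      integral_congr_ae h, smul_eq_mul]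
  obtain ⟨u, ⟨ν, hν, huν⟩, hmax⟩ :=
    exists_forall_apply_le_of_isClosed_convex_bounded hKne hKcl hKconv hKbdd φ
  refine ⟨ν, hν, fun ν' hν' h01' hb' => ?_⟩
  obtain ⟨v, hv, hvν⟩ := hlift ν' hν' h01' hb'
  rw [← hφ u ν huν, ← hφ v ν' hvν]
  exact hmax v hv

/-! ### The optimal values are attained -/

section Feasible

variable {Θ 𝒳 : Type*} [MeasurableSpace Θ]

/-- Both logarithms are nonnegative, so the constraint can be stated in `ℝ≥0∞`. -/
theorem complexity_add_log_eq (P₀ Q : Measure Θ) (n : ℕ) {δ : ℝ} (hδ : δ ∈ Set.Ioc (0 : ℝ) 1) :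
    complexity P₀ Q n + (Real.log (1 / δ) : EReal) =
      ((InformationTheory.klDiv Q P₀ +
        ENNReal.ofReal (Real.log (n.factorial / halfRising n) + Real.log (1 / δ)) : ℝ≥0∞) :
          EReal) := by
  have h1 := Real.log_nonneg (one_le_factorial_div_halfRising n)
  have h2 := Real.log_nonneg ((one_le_div hδ.1).2 hδ.2)
  rw [complexity, sqrt_pi_mul_Gamma_div_Gamma, EReal.coe_ennreal_add, EReal.coe_ennreal_ofReal,
    max_eq_left (add_nonneg h1 h2), EReal.coe_add, add_assoc]

theorem mem_feasibleMeans_iff (f : Θ × 𝒳 → ℝ) (P₀ Q : Measure Θ) {δ : ℝ}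
    (hδ : δ ∈ Set.Ioc (0 : ℝ) 1) {n : ℕ} (x : Fin n → 𝒳) (ν : Θ → ℝ) :
    ν ∈ feasibleMeans f P₀ Q δ x ↔ Measurable ν ∧ (∀ θ, ν θ ∈ Set.Icc (0 : ℝ) 1) ∧
      ∫⁻ θ, (optLogWealth (fun i => f (θ, x i)) (ν θ)).toENNReal ∂Q ≤
        InformationTheory.klDiv Q P₀ +
          ENNReal.ofReal (Real.log (n.factorial / halfRising n) + Real.log (1 / δ)) := by
  rw [feasibleMeans, Set.mem_ofPred_eq, complexity_add_log_eq P₀ Q n hδ,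
    EReal.coe_ennreal_le_coe_ennreal_iff]

theorem exists_mem_feasibleMeans_forall_mul_integral_le [MeasurableSpace 𝒳] {f : Θ × 𝒳 → ℝ}
    (hf : Measurable f) (hf01 : ∀ z, f z ∈ Set.Icc (0 : ℝ) 1) (P₀ Q : Measure Θ)
    [IsProbabilityMeasure Q] {δ : ℝ} (hδ : δ ∈ Set.Ioc (0 : ℝ) 1) {n : ℕ} (x : Fin n → 𝒳)
    (r : ℝ) :
    ∃ ν ∈ feasibleMeans f P₀ Q δ x, ∀ ν' ∈ feasibleMeans f P₀ Q δ x,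
      r * ∫ θ, ν' θ ∂Q ≤ r * ∫ θ, ν θ ∂Q := by
  have hfx : ∀ i, Measurable fun θ => f (θ, x i) := fun i => hf.comp measurable_prodMk_right
  obtain ⟨ν, hν, hmax⟩ := exists_forall_mul_integral_le Q
    (Ψ := fun θ m => (optLogWealth (fun i => f (θ, x i)) m).toENNReal)
    (InformationTheory.klDiv Q P₀ +
      ENNReal.ofReal (Real.log (n.factorial / halfRising n) + Real.log (1 / δ)))
    (fun ν hν h01 => measurable_toENNReal_optLogWealth hfx (fun i θ => hf01 _) hν h01)
    (fun θ u hu v hv s t hs ht hst =>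
      toENNReal_optLogWealth_convexCombination (fun i => hf01 _) hu hv hs ht hst)
    (fun θ u hu m h => toENNReal_optLogWealth_le_liminf (fun i => hf01 _) hu h)
    ⟨fun θ => (∑ i, f (θ, x i)) / n, (Finset.measurable_fun_sum _ fun i _ => hfx i).div_const _,
      fun θ => (toENNReal_optLogWealth_mean fun i => hf01 _).1, by
        simp [(toENNReal_optLogWealth_mean fun i => hf01 _).2]⟩ r
  refine ⟨ν, (mem_feasibleMeans_iff f P₀ Q hδ x ν).2 hν, fun ν' hν' => ?_⟩
  obtain ⟨h1, h2, h3⟩ := (mem_feasibleMeans_iff f P₀ Q hδ x ν').1 hν'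
  exact hmax ν' h1 h2 h3

theorem isGreatest_maxMean [MeasurableSpace 𝒳] {f : Θ × 𝒳 → ℝ}
    (hf : Measurable f) (hf01 : ∀ z, f z ∈ Set.Icc (0 : ℝ) 1) (P₀ Q : Measure Θ)
    [IsProbabilityMeasure Q] {δ : ℝ} (hδ : δ ∈ Set.Ioc (0 : ℝ) 1) {n : ℕ} (x : Fin n → 𝒳) :
    IsGreatest (objectiveValues f P₀ Q δ x) (maxMean f P₀ Q δ x) := by
  obtain ⟨ν, hν, hmax⟩ := exists_mem_feasibleMeans_forall_mul_integral_le hf hf01 P₀ Q hδ x 1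
  have h : IsGreatest (objectiveValues f P₀ Q δ x) (∫ θ, ν θ ∂Q) := by
    refine ⟨⟨ν, hν, rfl⟩, ?_⟩
    rintro _ ⟨ν', hν', rfl⟩
    simpa using hmax ν' hν'
  rwa [maxMean, h.csSup_eq]

theorem isLeast_minMean [MeasurableSpace 𝒳] {f : Θ × 𝒳 → ℝ}
    (hf : Measurable f) (hf01 : ∀ z, f z ∈ Set.Icc (0 : ℝ) 1) (P₀ Q : Measure Θ)
    [IsProbabilityMeasure Q] {δ : ℝ} (hδ : δ ∈ Set.Ioc (0 : ℝ) 1) {n : ℕ} (x : Fin n → 𝒳) :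
    IsLeast (objectiveValues f P₀ Q δ x) (minMean f P₀ Q δ x) := by
  obtain ⟨ν, hν, hmax⟩ := exists_mem_feasibleMeans_forall_mul_integral_le hf hf01 P₀ Q hδ x (-1)
  have h : IsLeast (objectiveValues f P₀ Q δ x) (∫ θ, ν θ ∂Q) := by
    refine ⟨⟨ν, hν, rfl⟩, ?_⟩
    rintro _ ⟨ν', hν', rfl⟩
    simpa using hmax ν' hν'
  rwa [minMean, h.csInf_eq]

end Feasible

/-! ### Coverage -/

section Coverage

/-- The side payoff is affine, so its mean is the denominator. The value is 1 unless that mean is 0,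
in which case the integral is 0. -/
theorem lintegral_sidePayoff_div_le_one {𝒳 : Type*} [MeasurableSpace 𝒳] {ρ : Measure 𝒳}
    [IsProbabilityMeasure ρ] {g : 𝒳 → ℝ} (hg : Measurable g) (hg01 : ∀ y, g y ∈ Set.Icc (0 : ℝ) 1)
    (a : Bool) :
    ∫⁻ y, ENNReal.ofReal (sidePayoff a (g y)) / ENNReal.ofReal (sidePayoff a (∫ y, g y ∂ρ)) ∂ρ ≤
      1 := by
  have hm : Measurable fun y => sidePayoff a (g y) := (measurable_sidePayoff a).comp hg
  have hint : Integrable g ρ := Integrable.of_bound hg.aestronglyMeasurable 1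
    (Eventually.of_forall fun y => by
      rw [Real.norm_eq_abs, abs_of_nonneg (hg01 y).1]; exact (hg01 y).2)
  have hside : Integrable (fun y => sidePayoff a (g y)) ρ ∧
      ∫ y, sidePayoff a (g y) ∂ρ = sidePayoff a (∫ y, g y ∂ρ) := by
    cases a
    · simp only [sidePayoff, Bool.false_eq_true, if_false]
      exact ⟨(integrable_const 1).sub hint, by
        rw [integral_sub (integrable_const 1) hint]; simp⟩
    · simpa [sidePayoff] using hint
  simp_rw [ENNReal.div_eq_inv_mul]
  rw [lintegral_const_mul _ hm.ennreal_ofReal,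
    ← ofReal_integral_eq_lintegral_ofReal hside.1
      (Eventually.of_forall fun y => sidePayoff_nonneg a (hg01 y)), hside.2]
  exact ENNReal.inv_mul_le_one _

theorem measurable_mixtureWealth {α : Type*} [MeasurableSpace α] {n : ℕ} {c : Fin n → α → ℝ}
    (hc : ∀ i, Measurable (c i)) {m : α → ℝ} (hm : Measurable m) :
    Measurable fun a => mixtureWealth (fun i => c i a) (m a) := by
  unfold mixtureWealth
  refine Finset.measurable_fun_sum _ fun b _ => measurable_const.mul
    (Finset.measurable_fun_prod _ fun i _ => Measurable.div ?_ ?_)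
  · exact ENNReal.measurable_ofReal.comp ((measurable_sidePayoff _).comp (hc i))
  · exact ENNReal.measurable_ofReal.comp ((measurable_sidePayoff _).comp hm)

end Coverage

theorem proposition4 {Ω 𝒳 Θ : Type*} [MeasurableSpace Ω] [MeasurableSpace 𝒳]
    [MeasurableSpace Θ] (μ : Measure Ω) [IsProbabilityMeasure μ]
    -- an i.i.d. sequence of data points
    (X : ℕ → Ω → 𝒳) (hX : ∀ i, Measurable (X i)) (hindep : iIndepFun X μ)
    (hident : ∀ i, IdentDistrib (X i) (X 0) μ μ)
    -- the function and the prior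
    (f : Θ × 𝒳 → ℝ) (hf : Measurable f) (hf01 : ∀ z, f z ∈ Set.Icc (0 : ℝ) 1)
    (P₀ : Measure Θ) [IsProbabilityMeasure P₀]
    (δ : ℝ) (hδ : δ ∈ Set.Ioc (0 : ℝ) 1) :
    -- the maximum and the minimum exist, for every sample and every posterior
    (∀ (n : ℕ) (x : Fin n → 𝒳) (Q : Measure Θ) [IsProbabilityMeasure Q],
      IsGreatest (objectiveValues f P₀ Q δ x) (maxMean f P₀ Q δ x) ∧
      IsLeast (objectiveValues f P₀ Q δ x) (minMean f P₀ Q δ x)) ∧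
    -- simultaneous coverage for all sample sizes and all data-dependent posteriors
    ∃ E : Set Ω, MeasurableSet E ∧ 1 - δ ≤ μ.real E ∧
      ∀ ω ∈ E, ∀ (n : ℕ) (P : Kernel (Fin n → 𝒳) Θ) [IsMarkovKernel P],
        let S : Fin n → 𝒳 := fun i => X i ω
        minMean f P₀ (P S) δ S ≤ ∫ θ, (∫ ω', f (θ, X 0 ω') ∂μ) ∂(P S) ∧
        ∫ θ, (∫ ω', f (θ, X 0 ω') ∂μ) ∂(P S) ≤ maxMean f P₀ (P S) δ S := by
  have hlaw : IsProbabilityMeasure (μ.map (X 0)) :=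
    Measure.isProbabilityMeasure_map (hX 0).aemeasurable
  refine ⟨fun n x Q _ => ⟨isGreatest_maxMean hf hf01 P₀ Q hδ x,
    isLeast_minMean hf hf01 P₀ Q hδ x⟩, ?_⟩
  set m : Θ → ℝ := fun θ => ∫ ω', f (θ, X 0 ω') ∂μ with hm
  have hfθ : ∀ θ, Measurable fun y => f (θ, y) := fun θ => hf.comp measurable_prodMk_left
  have hm_law : ∀ θ, m θ = ∫ y, f (θ, y) ∂(μ.map (X 0)) := fun θ =>
    (integral_map (hX 0).aemeasurable (hfθ θ).aestronglyMeasurable).symm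
  have hm_meas : Measurable m := by
    simp_rw [funext hm_law]
    exact (hf.stronglyMeasurable.integral_prod_right' (ν := μ.map (X 0))).measurable
  have hm01 : ∀ θ, m θ ∈ Set.Icc (0 : ℝ) 1 := by
    intro θ
    refine ⟨integral_nonneg fun ω => (hf01 _).1, ?_⟩
    have hle := integral_mono_of_nonneg (μ := μ) (f := fun ω => f (θ, X 0 ω)) (g := fun _ => 1)
      (Eventually.of_forall fun ω => (hf01 _).1) (integrable_const _)
      (Eventually.of_forall fun ω => (hf01 _).2)
    simpa using hle
  have hmix : ∀ n, Measurable fun z : (Fin n → 𝒳) × Θ =>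
      mixtureWealth (fun i => f (z.2, z.1 i)) (m z.2) := fun n =>
    measurable_mixtureWealth (c := fun i (z : (Fin n → 𝒳) × Θ) => f (z.2, z.1 i))
      (fun i => hf.comp (measurable_snd.prodMk ((measurable_pi_apply i).comp measurable_fst)))
      (hm_meas.comp measurable_snd)
  -- The prior average of the wealth at the true means; Tonelli's theorem transfers the
  -- supermartingale step to it.
  set G : ∀ n, (Fin n → 𝒳) → ℝ≥0∞ := fun n x =>
    ∫⁻ θ, mixtureWealth (fun i => f (θ, x i)) (m θ) ∂P₀ with hGdef
  have hG : ∀ n, Measurable (G n) := fun n => (hmix n).lintegral_prod_right'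
  have hG0 : ∀ x, G 0 x ≤ 1 := fun x => by simp [hGdef, mixtureWealth_zero]
  have hsnoc : ∀ n (x : Fin n → 𝒳) y θ,
      (fun i => f (θ, (Fin.snoc x y : Fin (n + 1) → 𝒳) i)) =
        (Fin.snoc (fun i => f (θ, x i)) (f (θ, y)) : Fin (n + 1) → ℝ) := by
    intro n x y θ
    funext i
    refine Fin.lastCases ?_ (fun i => ?_) i <;> simp
  have hstep : ∀ n x,
      ∫⁻ y, G (n + 1) (Fin.snoc x y : Fin (n + 1) → 𝒳) ∂(μ.map (X 0)) ≤ G n x := by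
    intro n x
    simp only [hGdef]
    rw [lintegral_lintegral_swap]
    · refine lintegral_mono fun θ => ?_
      simp only [hsnoc]
      refine lintegral_mixtureWealth_snoc_le (hfθ θ) (fun a => ?_) _
      rw [hm_law]
      exact lintegral_sidePayoff_div_le_one (hfθ θ) (fun y => hf01 _) a
    · refine Measurable.aemeasurable ?_
      refine measurable_mixtureWealth (c := fun i (z : 𝒳 × Θ) =>
        f (z.2, (Fin.snoc x z.1 : Fin (n + 1) → 𝒳) i)) (fun i => ?_) (hm_meas.comp measurable_snd)
      refine hf.comp (measurable_snd.prodMk ?_)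
      refine Fin.lastCases ?_ (fun i => ?_) i
      · simpa using measurable_fst
      · simp
  have hL : 1 ≤ 1 / δ := (one_le_div hδ.1).2 hδ.2
  set t : ℝ≥0∞ := ENNReal.ofReal (1 / δ) with ht
  set N : Set Ω := {ω | ∃ n, t ≤ G n fun i => X i ω} with hN
  have hNm : MeasurableSet N := by
    have : N = ⋃ n, {ω | t ≤ G n fun i => X i ω} := by ext; simp [hN]
    rw [this]
    exact MeasurableSet.iUnion fun n => measurableSet_le measurable_const
      ((hG n).comp (measurable_pi_lambda _ fun i => hX i))
  have hville : t * μ N ≤ 1 := mul_measure_exists_le_le_one hX hindep hident hG hstep hG0 t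
  have hNδ : μ.real N ≤ δ := by
    have h := ENNReal.toReal_mono ENNReal.one_ne_top hville
    rw [ENNReal.toReal_mul, ht, ENNReal.toReal_ofReal (by linarith), ENNReal.toReal_one] at h
    rwa [one_div, inv_mul_le_iff₀ hδ.1, mul_one] at h
  refine ⟨Nᶜ, hNm.compl, ?_, ?_⟩
  · rw [probReal_compl_eq_one_sub hNm]; linarith
  intro ω hω n P _ S
  have hint : ∫⁻ θ, mixtureWealth (fun i => f (θ, S i)) (m θ) ∂P₀ ≤ t := by
    by_contra h
    exact hω ⟨n, (not_le.1 h).le⟩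
  have hS : Measurable fun z : Θ => mixtureWealth (fun i => f (z, S i)) (m z) :=
    measurable_mixtureWealth (c := fun i θ => f (θ, S i))
      (fun i => hf.comp measurable_prodMk_right) hm_meas
  -- The moment bound `hint` depends on the sample alone, so it serves every kernel `P`.
  have hmem : m ∈ feasibleMeans f P₀ (P S) δ S := by
    refine (mem_feasibleMeans_iff f P₀ (P S) hδ S m).2 ⟨hm_meas, hm01, ?_⟩
    exact lintegral_le_klDiv_add_log
      (measurable_toENNReal_optLogWealth (c := fun i θ => f (θ, S i))
        (fun i => hf.comp measurable_prodMk_right) (fun i θ => hf01 _) hm_meas hm01) hS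
      (one_le_factorial_div_halfRising n) hL
      (fun θ hθ => toENNReal_optLogWealth_le_log_mixtureWealth (fun i => hf01 _) (hm01 θ) hθ) hint
  exact ⟨(isLeast_minMean hf hf01 P₀ (P S) hδ S).2 ⟨m, hmem, rfl⟩,
    (isGreatest_maxMean hf hf01 P₀ (P S) hδ S).2 ⟨m, hmem, rfl⟩⟩
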